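/- All graphs are finite, simple, undirected and have a non-empty vertex set. For a graph $G$ let $|G|$ be its number of vertices and let $\|G\| := |G| + 2\,|E^G|$ be its size, where $E^G$ is the symmetric edge relation, that is, the set of ordered pairs of adjacent vertices. A tree-decomposition of $G$ consists of a tree $T$ and a family $(B_t)_{t\in T}$ of sets of vertices of $G$ such that for every vertex $a$ the set $\{t \in T : a \in B_t\}$ is non-empty and connected in $T$, and every edge of $G$ has both its ends in some $B_t$. Its width is $\max_{t\in T}|B_t|-1$, and the tree-width $\mathrm{tw}(G)$ is the minimal width of a tree-decomposition of $G$. For $r\in\mathbb N$ let $N_r^G(a)$ be the set of vertices at distance at most $r$ from $a$, and let $$\mathrm{ltw}^G(r) := \max_{a}\ \mathrm{tw}\big(G[N_r^G(a)]\big),$$ where $a$ ranges over the vertices of $G$ and $G[N]$ is the induced subgraph. A class $\mathcal C$ of graphs has bounded local tree-width if there is a function $f:\mathbb N\to\mathbb N$ such that $\mathrm{ltw}^G(r)\le f(r)$ for all $G\in\mathcal C$ and all $r\in\mathbb N$. There is a class $\mathcal C$ of graphs of bounded local tree-width such that for every real constant $c$ there is a graph $G\in\mathcal C$ with $\|G\|\ge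 c\,|G|$. In particular, bounded local tree-width does not force linear size: there is no constant $c$ such that $\|G\|\le c\,|G|$ for all $G\in\mathcal C$. -/

import Mathlib

namespace LocalTW

/-- A tree-decomposition of a graph: a finite tree together with a block (a set of vertices of the
graph) for every node, such that the nodes whose blocks contain a given vertex form a non-empty
connected subset of the tree, and every edge is contained in some block. -/
structure TreeDecomposition {V : Type*} (G : SimpleGraph V) where
  /-- the nodes of the tree -/
  Node : Type
  [fintypeNode : Fintype Node]
  /-- the tree -/
  tree : SimpleGraph Node
  isTree : tree.IsTree
  /-- the blocks -/
  block : Node → Set V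
  connected_block : ∀ a : V, (tree.induce {t | a ∈ block t}).Connected
  edge_block : ∀ a b : V, G.Adj a b → ∃ t, a ∈ block t ∧ b ∈ block t

attribute [instance] TreeDecomposition.fintypeNode

/-- The width of a tree-decomposition: the maximal cardinality of a block, minus one.
On a non-empty finite graph some block is non-empty, so the subtraction does not truncate. -/
noncomputable def TreeDecomposition.width {V : Type*} [Finite V] {G : SimpleGraph V}
    (D : TreeDecomposition G) : ℕ :=
  (Finset.univ.sup fun t => (D.block t).ncard) - 1

/-- The tree-decomposition with a single block. -/
def TreeDecomposition.trivial {V : Type*} (G : SimpleGraph V) : TreeDecomposition G where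
  Node := Unit
  tree := ⊥
  isTree := SimpleGraph.IsTree.of_subsingleton
  block := fun _ => Set.univ
  connected_block := fun _ =>
    { preconnected := fun s t => by rw [Subsingleton.elim s t]
      nonempty := ⟨⟨(), _root_.trivial⟩⟩ }
  edge_block := fun _ _ _ => ⟨(), _root_.trivial, _root_.trivial⟩

/-- The tree-width of a finite graph: the minimal width of a tree-decomposition. -/
noncomputable def treeWidth {V : Type*} [Finite V] (G : SimpleGraph V) : ℕ :=
  sInf (Set.range fun D : TreeDecomposition G => D.width)

/-- The minimum in the definition of tree-width is attained. -/
theorem exists_width_eq_treeWidth {V : Type*} [Finite V] (G : SimpleGraph V) :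
    ∃ D : TreeDecomposition G, D.width = treeWidth G :=
  Nat.sInf_mem (Set.range_nonempty_iff_nonempty.2 ⟨TreeDecomposition.trivial G⟩)

/-- The `r`-neighbourhood of a vertex: all vertices at distance at most `r` from it
(vertices in other components have distance `⊤`). -/
def nbhd {V : Type*} (G : SimpleGraph V) (r : ℕ) (a : V) : Set V :=
  {b | G.edist a b ≤ (r : ℕ∞)}

/-- A finite graph with a non-empty vertex set. -/
structure FinGraph where
  /-- the vertices -/
  V : Type
  [fintypeV : Fintype V]
  [nonemptyV : Nonempty V]
  /-- the (symmetric, irreflexive) edge relation -/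
  graph : SimpleGraph V

attribute [instance] FinGraph.fintypeV FinGraph.nonemptyV

/-- The number `|G|` of vertices. -/
def FinGraph.order (G : FinGraph) : ℕ := Fintype.card G.V

/-- The size `‖G‖` of a graph, viewed as a structure with one symmetric binary relation `E`:
the number of vertices plus twice the number of ordered pairs in `E`. -/
noncomputable def FinGraph.size (G : FinGraph) : ℕ :=
  G.order + 2 * {p : G.V × G.V | G.graph.Adj p.1 p.2}.ncard

/-- The local tree-width of a graph, as a function of the radius. -/
noncomputable def FinGraph.localTreeWidth (G : FinGraph) (r : ℕ) : ℕ :=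
  Finset.univ.sup fun a : G.V => treeWidth (G.graph.induce (nbhd G.graph r a))

/-- A class of graphs has bounded local tree-width. -/
def BoundedLocalTreeWidth (C : Set FinGraph) : Prop :=
  ∃ f : ℕ → ℕ, ∀ G ∈ C, ∀ r : ℕ, G.localTreeWidth r ≤ f r

end LocalTW

/-!
The class consists of Cayley graphs `treelikeGraph k` of degree `k` in which every ball of radius
at most `k` is a tree. Large degree makes the ratio of size to order unbounded. For the local
tree-width at radius `r`, all members with `k ≥ r` contribute at most `1`, and the finitely many
members with `k < r` contribute at most their order; so the local tree-width is bounded by a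
function of `r` alone (`boundedLocalTreeWidth_range_treelikeGraph`).

The group is the group of all permutations of the set of reduced words of length at most `R` over
`d` letters, and the generators are the `d` involutions which put a letter in front of a word or
cancel it. Applied to the empty word, the product of the generators along a path of length at most
`R` spells out the edges of the path. Hence the first edge of a short path from `b` to `a` depends
only on `a` and `b` (`ReducedWord.path_snd_eq`), and a vertex `b` in a ball of radius less than `R`
around `a` has at most one neighbour there that is not farther from `a` than `b`. A connected graph
with such a distance function is a tree, and has tree-width at most one
(`treeWidth_le_one_of_height`).
-/

namespace LocalTW

open SimpleGraph

/-! ### Bounds on the tree-width -/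

section TreeWidth

variable {V : Type*} [Finite V]

theorem treeWidth_le_width {G : SimpleGraph V} (D : TreeDecomposition G) :
    treeWidth G ≤ D.width :=
  Nat.sInf_le ⟨D, rfl⟩

theorem treeWidth_le_card (G : SimpleGraph V) : treeWidth G ≤ Nat.card V := by
  refine (treeWidth_le_width (TreeDecomposition.trivial G)).trans ((Nat.sub_le _ _).trans ?_)
  refine Finset.sup_le fun t _ => ?_
  exact (Set.ncard_le_ncard (Set.subset_univ _)).trans (Set.ncard_univ V).le

end TreeWidth

/-- A cycle would contain a vertex of maximal height, and that vertex would have two neighbours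
which are not higher. -/
theorem isAcyclic_of_height {V : Type*} {H : SimpleGraph V} (h : V → ℕ)
    (unique : ∀ b x y, H.Adj b x → H.Adj b y → h x ≤ h b → h y ≤ h b → x = y) :
    H.IsAcyclic := by
  classical
  intro v c hc
  obtain ⟨b, hb, hmax⟩ := c.support.toFinset.exists_max_image h
    ⟨v, List.mem_toFinset.2 c.start_mem_support⟩
  rw [List.mem_toFinset] at hb
  have hc' := hc.rotate hb
  have hle : ∀ x ∈ (c.rotate b hb).support, h x ≤ h b := fun x hx =>
    hmax x (List.mem_toFinset.2 (by simpa using hx))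
  exact hc'.snd_ne_penultimate <| unique b _ _
    ((c.rotate b hb).adj_snd hc'.not_nil) ((c.rotate b hb).adj_penultimate hc'.not_nil).symm
    (hle _ (Walk.getVert_mem_support _ _)) (hle _ (Walk.getVert_mem_support _ _))

/-- The graph is itself the tree of the decomposition; the block of a vertex consists of the vertex
and its neighbour that is not higher, if there is one. -/
theorem treeWidth_le_one_of_height {V : Type} [Finite V] {H : SimpleGraph V}
    (hconn : H.Connected) (h : V → ℕ)
    (unique : ∀ b x y, H.Adj b x → H.Adj b y → h x ≤ h b → h y ≤ h b → x = y) :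
    treeWidth H ≤ 1 := by
  have := Fintype.ofFinite V
  let D : TreeDecomposition H :=
    { Node := V
      tree := H
      isTree := ⟨hconn, isAcyclic_of_height h unique⟩
      block := fun b => {x | x = b ∨ H.Adj b x ∧ h x ≤ h b}
      connected_block := fun a => by
        -- The nodes whose blocks contain `a` form a star with centre `a`.
        have : ∀ t : {t | a ∈ {x | x = t ∨ H.Adj t x ∧ h x ≤ h t}},
            (H.induce {t | a ∈ {x | x = t ∨ H.Adj t x ∧ h x ≤ h t}}).Reachable ⟨a, Or.inl rfl⟩ t := by
          rintro ⟨t, rfl | ht⟩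
          · exact Reachable.refl _
          · exact Adj.reachable (by simpa using ht.1.symm)
        exact (connected_iff_exists_forall_reachable _).2 ⟨_, this⟩
      edge_block := fun a b hab => by
        rcases le_total (h a) (h b) with hle | hle
        · exact ⟨b, Or.inr ⟨hab.symm, hle⟩, Or.inl rfl⟩
        · exact ⟨a, Or.inl rfl, Or.inr ⟨hab, hle⟩⟩ }
  refine (treeWidth_le_width D).trans (Nat.sub_le_of_le_add (Finset.sup_le fun b _ => ?_))
  have hsub : {x | H.Adj b x ∧ h x ≤ h b}.Subsingleton := fun x hx y hy =>
    unique b x y hx.1 hy.1 hx.2 hy.2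
  calc (D.block b).ncard ≤ ({b} ∪ {x | H.Adj b x ∧ h x ≤ h b} : Set V).ncard := le_rfl
    _ ≤ ({b} : Set V).ncard + {x | H.Adj b x ∧ h x ≤ h b}.ncard := Set.ncard_union_le _ _
    _ ≤ 1 + 1 := Nat.add_le_add (Set.ncard_singleton b).le (Set.ncard_le_one_iff_subsingleton.2 hsub)

/-! ### Neighbourhoods of a vertex -/

theorem exists_walk_of_mem_nbhd {V : Type*} {G : SimpleGraph V} {r : ℕ} {a b : V}
    (hb : b ∈ nbhd G r a) : ∃ p : G.Walk a b, p.length = G.dist a b ∧ p.length ≤ r := by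
  have hb : G.edist a b ≤ r := hb
  have hr : G.Reachable a b := edist_ne_top_iff_reachable.1 (ne_top_of_le_ne_top (by simp) hb)
  obtain ⟨p, hp⟩ := hr.exists_walk_length_eq_dist
  refine ⟨p, hp, ?_⟩
  rw [hp]
  rw [← hr.coe_dist_eq_edist] at hb
  exact_mod_cast hb

theorem connected_induce_nbhd {V : Type*} (G : SimpleGraph V) (r : ℕ) (a : V) :
    (G.induce (nbhd G r a)).Connected := by
  classical
  have ha : a ∈ nbhd G r a := by simp [nbhd]
  refine (connected_iff_exists_forall_reachable _).2 ⟨⟨a, ha⟩, fun ⟨b, hb⟩ => ?_⟩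
  obtain ⟨p, -, hp⟩ := exists_walk_of_mem_nbhd hb
  refine ⟨p.induce _ fun x hx => ?_⟩
  refine (edist_le (p.takeUntil x hx)).trans ?_
  exact_mod_cast (p.length_takeUntil_le_length hx).trans hp

/-- A path that starts with a step from `b` to a neighbour that is not farther from `a`: a
shortest path from that neighbour to `a` cannot pass through `b`. -/
theorem exists_isPath_snd_eq {V : Type*} {G : SimpleGraph V} {r : ℕ} {a b x : V}
    (hx : x ∈ nbhd G r a) (hbx : G.Adj b x) (hle : G.dist a x ≤ G.dist a b) :
    ∃ p : G.Walk b a, p.IsPath ∧ 0 < p.length ∧ p.length ≤ r + 1 ∧ p.snd = x := by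
  classical
  obtain ⟨q, hq, hqr⟩ := exists_walk_of_mem_nbhd hx
  have hb : b ∉ q.support := fun hb => by
    have h1 := q.length_takeUntil_lt_length hb hbx.ne
    have h2 := dist_le (q.takeUntil b hb)
    omega
  refine ⟨Walk.cons hbx q.reverse, ?_, by simp, by simpa using hqr, by simp⟩
  rw [Walk.cons_isPath_iff]
  exact ⟨(q.isPath_of_length_eq_dist hq).reverse, by simpa using hb⟩

/-! ### Cayley graphs generated by involutions of reduced words -/

/-- The words of length at most `R` over an alphabet of `d` letters in which consecutive letters
are distinct. They are the vertices of the ball of radius `R` in the `d`-regular tree. -/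
abbrev ReducedWord (d R : ℕ) : Type :=
  {l : List (Fin d) // l.IsChain (· ≠ ·) ∧ l.length ≤ R}

instance (d R : ℕ) : Finite (ReducedWord d R) :=
  Set.Finite.subset (List.finite_length_le (Fin d) R) fun _ hl => hl.2

namespace ReducedWord

variable {d R : ℕ}

/-- The empty word. -/
def empty : ReducedWord d R := ⟨[], by simp⟩

/-- Multiplication by the letter `i`, regarded as an involution: a leading `i` is cancelled, and
otherwise `i` is put in front. Words of maximal length not starting with `i` are fixed. -/
def toggle (i : Fin d) (w : ReducedWord d R) : ReducedWord d R :=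
  if h : w.1.head? = some i then ⟨w.1.tail, w.2.1.tail, by have := w.2.2; simp; omega⟩
  else if hlen : w.1.length < R then
    ⟨i :: w.1, by
      rw [List.isChain_cons]
      exact ⟨fun y hy hiy => h (hiy ▸ hy), w.2.1⟩, hlen⟩
  else w

theorem toggle_of_head?_ne {i : Fin d} {w : ReducedWord d R} (h : w.1.head? ≠ some i)
    (hlen : w.1.length < R) : (toggle i w).1 = i :: w.1 := by
  simp [toggle, h, hlen]

theorem toggle_toggle (i : Fin d) (w : ReducedWord d R) : toggle i (toggle i w) = w := by
  apply Subtype.ext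
  by_cases h : w.1.head? = some i
  · obtain ⟨t, ht⟩ := List.head?_eq_some_iff.1 h
    have h1 : (toggle i w).1 = t := by simp [toggle, ht]
    have hch := w.2.1
    have hlen := w.2.2
    rw [ht] at hch hlen
    rw [toggle_of_head?_ne, h1, ht]
    · rw [h1]
      exact fun h2 => (List.isChain_cons.1 hch).1 i h2 rfl
    · rw [h1]
      exact hlen
  · by_cases hlen : w.1.length < R
    · have h1 := toggle_of_head?_ne h hlen
      have h2 : (toggle i w).1.head? = some i := by simp [h1]
      rw [toggle, dif_pos h2]
      simp [h1]
    · have h1 : toggle i w = w := by simp [toggle, h, hlen]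
      rw [h1, h1]

/-- The involution `toggle i` as a permutation of the reduced words. -/
def perm (i : Fin d) : Equiv.Perm (ReducedWord d R) :=
  Function.Involutive.toPerm (toggle i) (toggle_toggle i)

theorem perm_mul_perm_mul (i : Fin d) (g : Equiv.Perm (ReducedWord d R)) :
    perm i * (perm i * g) = g := by
  ext1 w
  exact toggle_toggle i (g w)

theorem perm_apply_empty (hR : 0 < R) (i : Fin d) : (perm (R := R) i empty).1 = [i] :=
  toggle_of_head?_ne (by simp [empty]) (by simpa [empty] using hR)

/-- The Cayley graph of the group of all permutations of the reduced words with respect to the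
involutions `perm i`. -/
def cayleyGraph (d R : ℕ) : SimpleGraph (Equiv.Perm (ReducedWord d R)) where
  Adj g h := g ≠ h ∧ ∃ i, h = perm i * g
  symm := ⟨by
    rintro g _ ⟨hne, i, rfl⟩
    exact ⟨hne.symm, i, (perm_mul_perm_mul i g).symm⟩⟩
  loopless := ⟨fun _ h => h.1 rfl⟩

/-- Along a path of length at most `R` ending in `a`, read backwards, each generator puts a new
letter in front of the word, since cancelling a letter would mean going back along the last edge.
The first letter of the word `(b * a⁻¹) []` therefore names the first edge of every short path
from `b` to `a`. -/
theorem path_snd_eq {a b : Equiv.Perm (ReducedWord d R)} (p : (cayleyGraph d R).Walk b a)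
    (hp : p.IsPath) (hR : p.length ≤ R) :
    ((b * a⁻¹) empty).1.length = p.length ∧
      ∀ i ∈ ((b * a⁻¹) empty).1.head?, p.snd = perm i * b := by
  induction p with
  | nil => simp [empty]
  | @cons b x a hbx q ih =>
    rw [Walk.cons_isPath_iff] at hp
    rw [Walk.length_cons] at hR
    obtain ⟨hlen, hhead⟩ := ih hp.1 (by omega)
    obtain ⟨i, rfl⟩ : ∃ i, b = perm i * x := hbx.symm.2
    have hne : ((x * a⁻¹) empty).1.head? ≠ some i := fun h =>
      hp.2 (hhead i h ▸ q.getVert_mem_support 1)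
    have hcons : ((perm i * x * a⁻¹ : Equiv.Perm (ReducedWord d R)) empty).1 = i :: ((x * a⁻¹) empty).1 :=
      toggle_of_head?_ne (w := (x * a⁻¹) empty) hne (by omega)
    rw [hcons]
    refine ⟨congrArg Nat.succ hlen, fun j hj => ?_⟩
    obtain rfl : i = j := by simpa using hj
    simp [perm_mul_perm_mul]

theorem treeWidth_induce_nbhd_cayleyGraph_le_one {r : ℕ} (hr : r < R)
    (a : Equiv.Perm (ReducedWord d R)) :
    treeWidth ((cayleyGraph d R).induce (nbhd (cayleyGraph d R) r a)) ≤ 1 := by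
  refine treeWidth_le_one_of_height (connected_induce_nbhd _ r a)
    (fun b => (cayleyGraph d R).dist a b) ?_
  rintro ⟨b, hb⟩ ⟨x, hx⟩ ⟨y, hy⟩ hbx hby hxb hyb
  obtain ⟨p, hp, hpos, hpr, rfl⟩ := exists_isPath_snd_eq hx hbx hxb
  obtain ⟨q, hq, -, hqr, rfl⟩ := exists_isPath_snd_eq hy hby hyb
  obtain ⟨hp1, hp2⟩ := path_snd_eq p hp (by omega)
  have hq2 := (path_snd_eq q hq (by omega)).2
  obtain ⟨i, hi⟩ : ∃ i, ((b * a⁻¹) empty).1.head? = some i :=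
    ⟨_, List.head?_eq_some_head (List.ne_nil_of_length_pos (hp1 ▸ hpos))⟩
  exact Subtype.ext ((hp2 i hi).trans (hq2 i hi).symm)

/-- Every vertex has `d` neighbours, as the generators are distinct and different from the
identity: they send the empty word to the `d` words of length one. -/
theorem mul_card_le_ncard_adj (hR : 0 < R) :
    d * Nat.card (Equiv.Perm (ReducedWord d R)) ≤
      {p : Equiv.Perm (ReducedWord d R) × Equiv.Perm (ReducedWord d R) |
        (cayleyGraph d R).Adj p.1 p.2}.ncard := by
  let F : Fin d × Equiv.Perm (ReducedWord d R) →
      Equiv.Perm (ReducedWord d R) × Equiv.Perm (ReducedWord d R) := fun q => (q.2, perm q.1 * q.2)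
  have hF : Function.Injective F := by
    rintro ⟨i, g⟩ ⟨j, g'⟩ h
    obtain ⟨rfl, h⟩ : g = g' ∧ perm i * g = perm j * g' := Prod.mk.inj h
    have hij : perm (R := R) i = perm j := mul_right_cancel h
    have := perm_apply_empty hR i
    rw [hij, perm_apply_empty hR j] at this
    rw [List.singleton_inj.1 this]
  calc d * Nat.card (Equiv.Perm (ReducedWord d R))
      = Nat.card (Fin d × Equiv.Perm (ReducedWord d R)) := by simp [Nat.card_prod]
    _ = (Set.range F).ncard := by
      rw [← Set.image_univ, Set.ncard_image_of_injective _ hF, Set.ncard_univ]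
    _ ≤ _ := by
      refine Set.ncard_le_ncard ?_
      rintro _ ⟨⟨i, g⟩, rfl⟩
      refine ⟨fun h => ?_, i, rfl⟩
      have h1 : perm (R := R) i = 1 := right_eq_mul.1 h
      have := perm_apply_empty hR i
      simp [h1, empty] at this

end ReducedWord

/-! ### The class of graphs -/

/-- The Cayley graph of degree `k` whose balls of radius at most `k` are trees. -/
noncomputable def treelikeGraph (k : ℕ) : FinGraph where
  V := Equiv.Perm (ReducedWord k (k + 1))
  fintypeV := Fintype.ofFinite _
  graph := ReducedWord.cayleyGraph k (k + 1)

theorem localTreeWidth_treelikeGraph_le_one {k r : ℕ} (hr : r ≤ k) :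
    (treelikeGraph k).localTreeWidth r ≤ 1 :=
  Finset.sup_le fun a _ =>
    ReducedWord.treeWidth_induce_nbhd_cayleyGraph_le_one (Nat.lt_succ_of_le hr) a

theorem FinGraph.localTreeWidth_le_order (G : FinGraph) (r : ℕ) :
    G.localTreeWidth r ≤ G.order := by
  refine Finset.sup_le fun a _ => (treeWidth_le_card _).trans ?_
  rw [FinGraph.order, ← Nat.card_eq_fintype_card]
  exact Nat.card_le_card_of_injective _ Subtype.val_injective

theorem boundedLocalTreeWidth_range_treelikeGraph :
    BoundedLocalTreeWidth (Set.range treelikeGraph) := by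
  refine ⟨fun r => 1 + ∑ k ∈ Finset.range r, (treelikeGraph k).order, ?_⟩
  rintro _ ⟨k, rfl⟩ r
  rcases le_or_gt r k with hr | hr
  · exact (localTreeWidth_treelikeGraph_le_one hr).trans (Nat.le_add_right _ _)
  · calc (treelikeGraph k).localTreeWidth r ≤ (treelikeGraph k).order :=
        FinGraph.localTreeWidth_le_order _ r
      _ ≤ ∑ k ∈ Finset.range r, (treelikeGraph k).order :=
        Finset.single_le_sum (f := fun k => (treelikeGraph k).order) (fun _ _ => Nat.zero_le _)
          (Finset.mem_range.2 hr)
      _ ≤ _ := Nat.le_add_left _ _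

theorem mul_order_le_size_treelikeGraph (k : ℕ) :
    k * (treelikeGraph k).order ≤ (treelikeGraph k).size := by
  have h := ReducedWord.mul_card_le_ncard_adj (d := k) (R := k + 1) k.succ_pos
  have hcard : (treelikeGraph k).order = Nat.card (Equiv.Perm (ReducedWord k (k + 1))) :=
    Nat.card_eq_fintype_card.symm
  have hsize : (treelikeGraph k).size = (treelikeGraph k).order + 2 *
    {p : Equiv.Perm (ReducedWord k (k + 1)) × Equiv.Perm (ReducedWord k (k + 1)) |
        (ReducedWord.cayleyGraph k (k + 1)).Adj p.1 p.2}.ncard := rfl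
  rw [hsize, hcard]
  omega

end LocalTW

theorem mainTheorem7 :
    ∃ C : Set LocalTW.FinGraph,
      LocalTW.BoundedLocalTreeWidth C ∧
      (∀ c : ℝ, ∃ G ∈ C, c * (G.order : ℝ) ≤ (G.size : ℝ)) ∧
      ¬ ∃ c : ℝ, ∀ G ∈ C, (G.size : ℝ) ≤ c * (G.order : ℝ) := by
  have dense : ∀ c : ℝ, ∃ G ∈ Set.range LocalTW.treelikeGraph,
      c * (G.order : ℝ) ≤ (G.size : ℝ) := fun c => by
    refine ⟨_, ⟨⌈c⌉₊, rfl⟩, ?_⟩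
    calc c * ((LocalTW.treelikeGraph ⌈c⌉₊).order : ℝ)
        ≤ (⌈c⌉₊ : ℝ) * ((LocalTW.treelikeGraph ⌈c⌉₊).order : ℝ) := by
          gcongr
          exact Nat.le_ceil c
      _ ≤ _ := mod_cast LocalTW.mul_order_le_size_treelikeGraph ⌈c⌉₊
  refine ⟨_, LocalTW.boundedLocalTreeWidth_range_treelikeGraph, dense, ?_⟩
  rintro ⟨c, hc⟩
  obtain ⟨G, hG, h⟩ := dense (c + 1)
  have hpos : (0 : ℝ) < G.order := mod_cast Fintype.card_pos (α := G.V)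
  linarith [hc G hG]
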